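/- Let $S$ be a finite semigroup whose idempotents commute, and let $K$ be a field. Elements $s,t\in S$ are inverses of each other if $sts=s$ and $tst=t$; an element is regular if it has an inverse. The regular elements form a subsemigroup $R(S)$ (an inverse semigroup), in which every $u$ has a unique inverse $u^{-1}$. Order $R(S)$ by $s\le t$ iff $s=et$ for some idempotent $e$, and let $\mu$ be the Möbius function of this finite partially ordered set. In the semigroup algebra $KR(S)$ put $$\lfloor s\rfloor=\sum_{t\le s}\mu(t,s)\,t\qquad(s\in R(S)),$$ for $s\in S$ put $s^{\downarrow}=\{u\in R(S)\mid uu^{-1}s=u\}$, and let $\nu:KS\to KR(S)$ be the $K$-linear map with $\nu(s)=\sum_{t\in s^{\downarrow}}\lfloor t\rfloor$ for all $s\in S$. A representation $\rho:T\to M_n(K)$ of a semigroup $T$ (a multiplicative map) is irreducible if $n\ge 1$ and the only $T$-invariant subspaces of the space $K^n$ of row vectors are $0$ and $K^n$. Theorem. Let $\rho:S\to M_n(K)$ be an irreducible representation. Then: 1. the restriction $\rho|_{R(S)}$ is an irreducible representation of $R(S)$, and it is not identically zero if $\rho$ is not identically zero; 2. $\ker\nu\subseteq\ker\rho$, where $\rho$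 is extended linearly to $KS$. -/

import Mathlib

noncomputable section

namespace CommIdem

/-- The idempotents of the semigroup `S` commute with each other. -/
def IdempotentsCommute (S : Type*) [Semigroup S] : Prop :=
  ∀ e f : S, IsIdempotentElem e → IsIdempotentElem f → e * f = f * e

/-- `s` and `t` are inverses of each other. -/
def AreInverse {S : Type*} [Semigroup S] (s t : S) : Prop :=
  s * t * s = s ∧ t * s * t = t

/-- An element of a semigroup is (von Neumann) regular if it has an inverse. -/
def IsRegularElt {S : Type*} [Semigroup S] (s : S) : Prop :=
  ∃ t : S, AreInverse s t

section Inverses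

variable {S : Type*} [Semigroup S]

theorem AreInverse.symm {s t : S} (h : AreInverse s t) : AreInverse t s := ⟨h.2, h.1⟩

theorem AreInverse.idem {s t : S} (h : AreInverse s t) : IsIdempotentElem (s * t) := by
  change s * t * (s * t) = s * t
  rw [← mul_assoc, h.1]

/-- Inverses of regular elements are unique when idempotents commute. -/
theorem AreInverse.unique (hS : IdempotentsCommute S) {s t t' : S}
    (h : AreInverse s t) (h' : AreInverse s t') : t = t' := by
  have e1 : t * s * (t' * s) = t' * s * (t * s) := hS _ _ h.symm.idem h'.symm.idem
  have e2 : s * t * (s * t') = s * t' * (s * t) := hS _ _ h.idem h'.idem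
  have a1 : t = t' * s * t := by
    calc t = t * s * t := h.2.symm
      _ = t * (s * t' * s) * t := by rw [h'.1]
      _ = t * s * (t' * s) * t := by simp only [mul_assoc]
      _ = t' * s * (t * s) * t := by rw [e1]
      _ = t' * s * (t * s * t) := by simp only [mul_assoc]
      _ = t' * s * t := by rw [h.2]
  have a2 : t' = t' * s * t := by
    calc t' = t' * s * t' := h'.2.symm
      _ = t' * (s * t * s) * t' := by rw [h.1]
      _ = t' * (s * t * (s * t')) := by simp only [mul_assoc]
      _ = t' * (s * t' * (s * t)) := by rw [e2]
      _ = t' * s * t' * (s * t) := by simp only [mul_assoc]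
      _ = t' * s * t := by rw [h'.2, mul_assoc]
  rw [a1, ← a2]

theorem AreInverse.mul (hS : IdempotentsCommute S) {a a' b b' : S}
    (ha : AreInverse a a') (hb : AreInverse b b') : AreInverse (a * b) (b' * a') := by
  have e : b * b' * (a' * a) = a' * a * (b * b') := hS _ _ hb.idem ha.symm.idem
  constructor
  · calc a * b * (b' * a') * (a * b) = a * (b * b' * (a' * a)) * b := by simp only [mul_assoc]
      _ = a * (a' * a * (b * b')) * b := by rw [e]
      _ = a * a' * a * (b * b' * b) := by simp only [mul_assoc]
      _ = a * b := by rw [ha.1, hb.1]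
  · calc b' * a' * (a * b) * (b' * a') = b' * (a' * a * (b * b')) * a' := by simp only [mul_assoc]
      _ = b' * (b * b' * (a' * a)) * a' := by rw [e]
      _ = b' * b * b' * (a' * a * a') := by simp only [mul_assoc]
      _ = b' * a' := by rw [ha.2, hb.2]

/-- The subsemigroup `R(S)` of regular elements of a semigroup with commuting idempotents. -/
def regularPart (hS : IdempotentsCommute S) : Subsemigroup S where
  carrier := {s | IsRegularElt s}
  mul_mem' := by
    rintro a b ⟨a', ha⟩ ⟨b', hb⟩
    exact ⟨b' * a', ha.mul hS hb⟩

variable {hS : IdempotentsCommute S}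

/-- The inverse `u⁻¹` in `R(S)` of an element `u` of `R(S)`. -/
def inv (u : regularPart hS) : regularPart hS :=
  ⟨Classical.choose u.2, u, (Classical.choose_spec u.2).symm⟩

theorem inv_spec (u : regularPart hS) : AreInverse (u : S) (inv u : S) :=
  Classical.choose_spec u.2

/-- The natural partial order on `R(S)`: `s ≤ t` iff `s = e t` for some idempotent `e`. -/
instance naturalOrder : PartialOrder (regularPart hS) where
  le s t := ∃ e : regularPart hS, IsIdempotentElem e ∧ s = e * t
  le_refl s := ⟨s * inv s, Subtype.ext (inv_spec s).idem, Subtype.ext (inv_spec s).1.symm⟩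
  le_trans := by
    rintro a b c ⟨e, he, rfl⟩ ⟨f, hf, rfl⟩
    refine ⟨e * f, ?_, (mul_assoc _ _ _).symm⟩
    have hc : e * f = f * e := Subtype.ext
      (hS e f (congrArg Subtype.val he) (congrArg Subtype.val hf))
    change e * f * (e * f) = e * f
    calc e * f * (e * f) = e * (f * e) * f := by simp only [mul_assoc]
      _ = e * (e * f) * f := by rw [hc]
      _ = e * e * (f * f) := by simp only [mul_assoc]
      _ = e * f := by rw [he.eq, hf.eq]
  le_antisymm := by
    rintro s t ⟨e, he, h1⟩ ⟨f, hf, h2⟩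
    have hc : e * f = f * e := Subtype.ext
      (hS e f (congrArg Subtype.val he) (congrArg Subtype.val hf))
    have hft : f * t = t := by
      conv_lhs => rw [h2, ← mul_assoc, hf.eq, ← h2]
    calc s = e * t := h1
      _ = e * (f * t) := by rw [hft]
      _ = f * (e * t) := by rw [← mul_assoc, hc, mul_assoc]
      _ = t := by rw [← h1, ← h2]

end Inverses

section Algebra

variable {S : Type*} [Semigroup S] [Finite S] {hS : IdempotentsCommute S}

instance locallyFinite : LocallyFiniteOrder (regularPart hS) :=
  LocallyFiniteOrder.ofFiniteIcc fun _ _ => Set.toFinite _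

open Classical in
/-- The integer-valued Möbius function `μ(t, s)` of `R(S)` with its natural partial order. -/
def moebius (t s : regularPart hS) : ℤ := IncidenceAlgebra.mu ℤ t s

/-- The element `⌊s⌋ = ∑_{t ≤ s} μ(t, s) t` of the semigroup algebra `K R(S)`. -/
def floorElt (K : Type*) [Field K] (s : regularPart hS) : MonoidAlgebra K (regularPart hS) :=
  ∑ t ∈ (Set.toFinite {t : regularPart hS | t ≤ s}).toFinset,
    MonoidAlgebra.single t ((moebius t s : ℤ) : K)

/-- The set `s↓ = {u ∈ R(S) | u u⁻¹ s = u}`, for an arbitrary element `s` of `S`. -/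
def down (hS : IdempotentsCommute S) (s : S) : Set (regularPart hS) :=
  {u | (u : S) * (inv u : S) * s = (u : S)}

/-- The linear map `ν : K S → K R(S)` with `ν(s) = ∑_{t ∈ s↓} ⌊t⌋` for `s ∈ S`. -/
def nu (K : Type*) [Field K] (hS : IdempotentsCommute S) :
    MonoidAlgebra K S →ₗ[K] MonoidAlgebra K (regularPart hS) :=
  (MonoidAlgebra.basis S K).constr K fun s =>
    ∑ t ∈ (Set.toFinite (down hS s)).toFinset, floorElt K t

end Algebra

section Representations

variable {K : Type*} [Field K] {T : Type*} [Semigroup T] {n : ℕ}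

/-- A matrix representation `T → M_n(K)` of a semigroup is irreducible if `n ≥ 1` and the only
subspaces of `Kⁿ` (row vectors, acted upon on the right) which are invariant under `T` are the
zero subspace and `Kⁿ`. -/
def IsIrreducible (ρ : T →ₙ* Matrix (Fin n) (Fin n) K) : Prop :=
  0 < n ∧ ∀ W : Submodule K (Fin n → K),
    (∀ t : T, ∀ w ∈ W, Matrix.vecMul w (ρ t) ∈ W) → W = ⊥ ∨ W = ⊤

/-- The linear extension of a representation of `T` to the semigroup algebra `K T`. -/
def extend (ρ : T →ₙ* Matrix (Fin n) (Fin n) K) :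
    MonoidAlgebra K T →ₗ[K] Matrix (Fin n) (Fin n) K :=
  (MonoidAlgebra.basis T K).constr K fun t => ρ t

/-- The restriction of a representation to a subsemigroup. -/
def restrict (ρ : T →ₙ* Matrix (Fin n) (Fin n) K) (U : Subsemigroup T) :
    U →ₙ* Matrix (Fin n) (Fin n) K :=
  ρ.comp (MulMemClass.subtype U)

end Representations

end CommIdem

end

noncomputable section

namespace CommIdem

open Matrix

/-! ### Natural order and Möbius inversion on `R(S)`. -/

section Semigroups

variable {S : Type*} [Semigroup S]

/-! Everything follows from `extend_restrict_nu`: `ρ` on `KS` factors through `ν` as `ρ|R(S)` after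
`ν`. This gives the kernel inclusion, and it puts every `ρ s` in the span of `ρ(R(S))`, so `R(S)`
has the same invariant subspaces as `S`. The factorization is tested on row vectors fixed by some `ρ
e`, with `e` a minimal idempotent not killed by `ρ`; these span `Kⁿ` (`span_fixed_eq_top`). For such
`e`, a product `e * s` is either killed by `ρ` or regular and `R`-equivalent to `e`. Hence `ρ (e *
s)` is the sum over `s↓` of `ρ` cut off to the `R`-class of `e`, and Möbius inversion identifies
that cutoff at `t` with `ρ e * ρ ⌊t⌋`. -/

theorem exists_isIdempotentElem_mem [Finite S] (L : Set S) (hne : L.Nonempty)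
    (hmul : ∀ a ∈ L, ∀ b ∈ L, a * b ∈ L) : ∃ f ∈ L, IsIdempotentElem f := by
  let _ : TopologicalSpace S := ⊥
  have : DiscreteTopology S := ⟨rfl⟩
  exact exists_idempotent_in_compact_subsemigroup (fun _ => continuous_of_discreteTopology) L hne
    (Set.toFinite L).isCompact hmul

variable {hS : IdempotentsCommute S}

theorem AreInverse.eq_inv {u : regularPart hS} {c : S} (h : AreInverse (u : S) c) :
    c = (inv u : S) :=
  h.unique hS (inv_spec u)

/-- On regular elements, the natural order is membership in the down-set. -/
theorem mem_down_iff_le {u t : regularPart hS} : u ∈ down hS (t : S) ↔ u ≤ t := by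
  constructor
  · intro h
    exact ⟨u * inv u, Subtype.ext (inv_spec u).idem, Subtype.ext h.symm⟩
  · rintro ⟨e, he, rfl⟩
    have he' : (e : S) * e = e := congrArg Subtype.val he
    have hinv : (inv t : S) * e = (inv (e * t) : S) := by
      apply AreInverse.eq_inv
      exact AreInverse.mul hS (a := (e : S)) (a' := e) ⟨by rw [he', he'], by rw [he', he']⟩
        (inv_spec t)
    have hc : (t : S) * inv t * e = e * (t * inv t) := hS _ _ (inv_spec t).idem he'
    change ((e * t : regularPart hS) : S) * (inv (e * t) : S) * t = ((e * t : regularPart hS) : S)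
    rw [← hinv]
    change (e : S) * t * (inv t * e) * t = e * t
    calc (e : S) * t * (inv t * e) * t = e * (t * inv t * e) * t := by simp only [mul_assoc]
      _ = e * e * (t * inv t * t) := by rw [hc]; simp only [mul_assoc]
      _ = e * t := by rw [he', (inv_spec t).1]

/-- Möbius inversion on `R(S)`. -/
theorem sum_moebius_smul_sum [Finite S] {M : Type*} [AddCommGroup M]
    (G : regularPart hS → M) (t : regularPart hS) :
    ∑ x ∈ (Set.toFinite {x : regularPart hS | x ≤ t}).toFinset,
      moebius x t • ∑ y ∈ (Set.toFinite {y : regularPart hS | y ≤ x}).toFinset, G y = G t := by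
  classical
  calc _ = ∑ y ∈ (Set.toFinite {y : regularPart hS | y ≤ t}).toFinset,
        ∑ x ∈ Finset.Icc y t, moebius x t • G y := by
        simp only [Finset.smul_sum]
        apply Finset.sum_comm'
        intro x y
        simp only [Set.Finite.mem_toFinset, Set.mem_ofPred_eq, Finset.mem_Icc]
        exact ⟨fun h => ⟨⟨h.2, h.1⟩, h.2.trans h.1⟩, fun h => ⟨h.1.2, h.1.1⟩⟩
    _ = ∑ y ∈ (Set.toFinite {y : regularPart hS | y ≤ t}).toFinset,
        (if y = t then (1 : ℤ) else 0) • G y := by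
        refine Finset.sum_congr rfl fun y _ => ?_
        rw [← Finset.sum_smul, ← IncidenceAlgebra.sum_Icc_mu_left (𝕜 := ℤ) y t]
        refine congrArg (· • G y) (Finset.sum_congr rfl fun x _ => ?_)
        unfold moebius
        congr!
    _ = G t := by simp

end Semigroups

/-! ### Irreducible representations and minimal idempotents. -/

section Representations

variable {S : Type*} [Semigroup S] {K : Type*} [Field K] {n : ℕ}
  {ρ : S →ₙ* Matrix (Fin n) (Fin n) K}

@[simp]
theorem extend_single {T : Type*} [Semigroup T] (σ : T →ₙ* Matrix (Fin n) (Fin n) K)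
    (t : T) (a : K) : extend σ (MonoidAlgebra.single t a) = a • σ t := by
  have h : MonoidAlgebra.single t a = a • MonoidAlgebra.basis T K t := by
    simp [MonoidAlgebra.basis_apply]
  rw [h, map_smul, extend, Module.Basis.constr_basis]

/-- An irreducible representation of a finite semigroup which does not vanish at `x` does not
vanish at some idempotent of the ideal generated by `x`. -/
theorem exists_isIdempotentElem_map_ne_zero [Finite S] (hρ : IsIrreducible ρ) {x : S}
    (hx : ρ x ≠ 0) : ∃ a b : S, IsIdempotentElem (a * x * b) ∧ ρ (a * x * b) ≠ 0 := by
  -- The vectors killed by the left ideal `L = S¹x` form an invariant subspace, which is proper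
  -- because `ρ x ≠ 0`. So a nonzero `v ᵥ* ρ p` always survives some `y ∈ L`.
  let L : Set S := {z | z = x ∨ ∃ a, z = a * x}
  have hL : ∀ a, ∀ b ∈ L, a * b ∈ L := by
    rintro a b (rfl | ⟨c, rfl⟩)
    · exact Or.inr ⟨a, rfl⟩
    · exact Or.inr ⟨a * c, (mul_assoc _ _ _).symm⟩
  let W : Submodule K (Fin n → K) :=
    { carrier := {w | ∀ y ∈ L, w ᵥ* ρ y = 0}
      add_mem' := fun {v w} hv hw y hy => by rw [add_vecMul, hv y hy, hw y hy, add_zero]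
      zero_mem' := fun y _ => zero_vecMul _
      smul_mem' := fun c w hw y hy => by rw [smul_vecMul, hw y hy, smul_zero] }
  have hW : W = ⊥ := by
    refine (hρ.2 W fun t w hw y hy => ?_).resolve_right fun htop => hx ?_
    · rw [vecMul_vecMul, ← map_mul]
      exact hw _ (hL t y hy)
    · refine ext_iff_vecMul.2 fun v => ?_
      have hv : v ∈ W := htop ▸ Submodule.mem_top
      rw [hv x (Or.inl rfl), vecMul_zero]
  obtain ⟨v, hv⟩ : ∃ v, v ᵥ* ρ x ≠ 0 := by
    by_contra! h
    exact hx (ext_iff_vecMul.2 fun v => by rw [h, vecMul_zero])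
  have step : ∀ p : {p : S // v ᵥ* ρ p ≠ 0}, ∃ y ∈ L, v ᵥ* ρ (p * y) ≠ 0 := by
    rintro ⟨p, hp⟩
    by_contra! h
    have : v ᵥ* ρ p ∈ W := fun y hy => by rw [vecMul_vecMul, ← map_mul, h y hy]
    rw [hW, Submodule.mem_bot] at this
    exact hp this
  choose y hyL hy using step
  let F : {p : S // v ᵥ* ρ p ≠ 0} → {p : S // v ᵥ* ρ p ≠ 0} := fun p => ⟨p * y p, hy p⟩
  have iter : ∀ (m : ℕ) p, ∃ z ∈ L, (F^[m + 1] p : S) = p * z := by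
    intro m
    induction m with
    | zero => exact fun p => ⟨y p, hyL p, rfl⟩
    | succ m ih =>
      intro p
      obtain ⟨z, hz, h⟩ := ih (F p)
      refine ⟨y p * z, hL _ _ hz, ?_⟩
      rw [Function.iterate_succ_apply, h, ← mul_assoc]
  -- By finiteness the orbit of `F` repeats. The elements of `L` fixing `p` on the right then form a
  -- nonempty subsemigroup, and an idempotent in it cannot be killed by `ρ`.
  obtain ⟨p, z, hz, hpz⟩ : ∃ p : {p : S // v ᵥ* ρ p ≠ 0}, ∃ z ∈ L, (p : S) * z = p := by
    obtain ⟨i, j, hij, h⟩ := Finite.exists_ne_map_eq_of_infinite fun m : ℕ => F^[m] ⟨x, hv⟩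
    wlog hlt : i < j generalizing i j
    · exact this j i hij.symm h.symm (by omega)
    obtain ⟨k, rfl⟩ : ∃ k, j = k + 1 + i := ⟨j - i - 1, by omega⟩
    obtain ⟨z, hz, hk⟩ := iter k (F^[i] ⟨x, hv⟩)
    refine ⟨F^[i] ⟨x, hv⟩, z, hz, ?_⟩
    rw [← hk, ← Function.iterate_add_apply]
    exact congrArg Subtype.val h.symm
  obtain ⟨f, ⟨hfL, hpf⟩, hf⟩ := exists_isIdempotentElem_mem {z | z ∈ L ∧ (p : S) * z = p}
    ⟨z, hz, hpz⟩ fun a ha b hb => ⟨hL a b hb.1, by rw [← mul_assoc, ha.2, hb.2]⟩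
  have hf0 : ρ f ≠ 0 := fun h0 => p.2 (by rw [← hpf, map_mul, h0, mul_zero, vecMul_zero])
  obtain ⟨a, b, hab⟩ : ∃ a b, f = a * x * b := by
    rcases hfL with h | ⟨a, h⟩
    · exact ⟨f, f, by rw [← h, hf.eq, hf.eq]⟩
    · exact ⟨a, f, by rw [← h, hf.eq]⟩
  exact ⟨a, b, hab ▸ hf, hab ▸ hf0⟩

/-- `e` is minimal among the idempotents at which `ρ` does not vanish. -/
structure IsMinimalSupport (ρ : S →ₙ* Matrix (Fin n) (Fin n) K) (e : S) : Prop where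
  idem : IsIdempotentElem e
  map_ne_zero : ρ e ≠ 0
  eq_of_le : ∀ g, IsIdempotentElem g → e * g = g → g * e = g → ρ g ≠ 0 → g = e

theorem exists_isMinimalSupport [Finite S] (hρ : IsIrreducible ρ) {x : S} (hx : ρ x ≠ 0) :
    ∃ e, IsMinimalSupport ρ e := by
  obtain ⟨a, b, hi, h0⟩ := exists_isIdempotentElem_map_ne_zero hρ hx
  -- For idempotent `e` this set is the right ideal `eS`; minimality is taken under inclusion.
  obtain ⟨e, he, hmin⟩ := (Set.toFinite {e : S | IsIdempotentElem e ∧ ρ e ≠ 0}).exists_minimalFor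
    (fun e => {x : S | e * x = x}) _ ⟨_, hi, h0⟩
  refine ⟨e, he.1, he.2, fun g hg h1 h2 hg0 => ?_⟩
  have hle : {x : S | g * x = x} ≤ {x : S | e * x = x} := by
    intro x (hx : g * x = x)
    change e * x = x
    rw [← hx, ← mul_assoc, h1]
  have : g * e = e := hmin ⟨hg, hg0⟩ hle he.1
  rw [← h2, this]

/-- If `ρ` does not vanish at `e * s`, then `e * s` is regular and `R`-equivalent to `e`. -/
theorem IsMinimalSupport.exists_areInverse [Finite S] (hρ : IsIrreducible ρ) {e s : S}
    (he : IsMinimalSupport ρ e) (hs : ρ (e * s) ≠ 0) :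
    ∃ c, AreInverse (e * s) c ∧ e * s * c = e := by
  obtain ⟨a, b, hf, hf0⟩ := exists_isIdempotentElem_map_ne_zero hρ hs
  have hee : e * e = e := he.idem
  set f := a * (e * s) * b with hfdef
  have hff : f * f = f := hf
  -- Since `f = (a * e) * (e * s * b * f)`, swapping the two factors yields an idempotent `g` below
  -- `e` that `ρ` does not kill either, so `g = e`.
  set g := e * s * b * f * (a * e) with hgdef
  have hyx : a * e * (e * s * b * f) = f := by
    calc a * e * (e * s * b * f) = a * (e * e * s) * b * f := by simp only [mul_assoc]
      _ = f * f := by rw [hee]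
      _ = f := hff
  have hg : IsIdempotentElem g := by
    calc g * g = e * s * b * f * (a * e * (e * s * b * f)) * (a * e) := by
          simp only [hgdef, mul_assoc]
      _ = e * s * b * (f * f) * (a * e) := by rw [hyx]; simp only [mul_assoc]
      _ = g := by rw [hff]
  have hge : g * e = g := by simp only [hgdef, mul_assoc, hee]
  have heg : e * g = g := by simp only [hgdef, ← mul_assoc, hee]
  have hg0 : ρ g ≠ 0 := by
    intro h0
    apply hf0
    have : f = a * e * g * (e * s * b * f) := by
      calc f = f * f := hff.symm
        _ = (a * e * (e * s * b * f)) * (a * e * (e * s * b * f)) := by rw [hyx]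
        _ = a * e * g * (e * s * b * f) := by simp only [hgdef, mul_assoc]
    rw [this, map_mul, map_mul ρ (a * e), h0, mul_zero, zero_mul]
  have hgeq : g = e := he.eq_of_le g hg heg hge hg0
  have h1 : e * s * (b * f * (a * e)) = e := by
    rw [← mul_assoc (e * s), ← mul_assoc (e * s)]
    exact hgeq
  refine ⟨b * f * (a * e), ⟨?_, ?_⟩, h1⟩
  · rw [h1, ← mul_assoc, hee]
  · rw [mul_assoc _ (e * s), h1]
    simp only [mul_assoc, hee]

/-- Minimality passes along the `D`-class. -/
theorem IsMinimalSupport.conj {e u c : S} (he : IsMinimalSupport ρ e) (h : AreInverse u c)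
    (huc : u * c = e) : IsMinimalSupport ρ (c * u) := by
  subst huc
  refine ⟨h.symm.idem, fun h0 => he.map_ne_zero ?_, fun g hg h1 h2 hg0 => ?_⟩
  · have : u * c = u * (c * u) * c := by rw [← mul_assoc, h.1]
    rw [this, map_mul, map_mul, h0, mul_zero, zero_mul]
  -- Conjugation by `u` and `c` carries idempotents below `c * u` to idempotents below `u * c = e`.
  · have hcg : c * (u * g * c) * u = g := by
      calc c * (u * g * c) * u = c * u * g * (c * u) := by simp only [mul_assoc]
        _ = g := by rw [h1, h2]
    have key : u * g * c = u * c := by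
      apply he.eq_of_le
      · calc u * g * c * (u * g * c) = u * (g * (c * u) * g) * c := by simp only [mul_assoc]
          _ = u * g * c := by rw [h2, hg.eq]
      · rw [← mul_assoc, ← mul_assoc, h.1]
      · rw [mul_assoc (u * g), ← mul_assoc c, h.2]
      · intro h0
        apply hg0
        rw [← hcg, map_mul, map_mul, h0, mul_zero, zero_mul]
    rw [← hcg, key, ← mul_assoc, h.2]

/-- Row vectors fixed by minimal idempotents span the whole space. -/
theorem span_fixed_eq_top [Finite S] (hρ : IsIrreducible ρ) {x : S} (hx : ρ x ≠ 0) :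
    Submodule.span K {w : Fin n → K | ∃ e, IsMinimalSupport ρ e ∧ w ᵥ* ρ e = w} = ⊤ := by
  set A := {w : Fin n → K | ∃ e, IsMinimalSupport ρ e ∧ w ᵥ* ρ e = w}
  refine (hρ.2 (Submodule.span K A) fun t w hw => ?_).resolve_left fun hbot => ?_
  · have hA : A ⊆ (Submodule.span K A).comap (vecMulLinear (ρ t)) := by
      rintro w ⟨e, he, hwe⟩
      change w ᵥ* ρ t ∈ Submodule.span K A
      rw [← hwe, vecMul_vecMul, ← map_mul]
      by_cases h0 : ρ (e * t) = 0
      · rw [h0, vecMul_zero]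
        exact Submodule.zero_mem _
      -- The image vector is fixed by `c * (e * t)`, an idempotent `D`-equivalent to `e`, hence
      -- again minimal.
      · obtain ⟨c, hc, hce⟩ := he.exists_areInverse hρ h0
        refine Submodule.subset_span ⟨_, he.conj hc hce, ?_⟩
        rw [vecMul_vecMul, ← map_mul, ← mul_assoc, hc.1]
    exact Submodule.span_le.2 hA hw
  · obtain ⟨e, he⟩ := exists_isMinimalSupport hρ hx
    apply he.map_ne_zero
    refine ext_iff_vecMul.2 fun v => ?_
    have : v ᵥ* ρ e ∈ Submodule.span K A :=
      Submodule.subset_span ⟨e, he, by rw [vecMul_vecMul, ← map_mul, he.idem.eq]⟩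
    rw [hbot, Submodule.mem_bot] at this
    rw [this, vecMul_zero]

variable {hS : IdempotentsCommute S}

open Classical in
/-- The value of `ρ` at `u`, cut off to the `R`-class of the idempotent `e`. -/
def cutoff (ρ : S →ₙ* Matrix (Fin n) (Fin n) K) (e : S) (u : regularPart hS) :
    Matrix (Fin n) (Fin n) K :=
  if (u : S) * inv u = e then ρ u else 0

/-- Only `u = e * s` can contribute, since `u * u⁻¹ = e` and `u ∈ s↓` force it; when `ρ (e * s) ≠ 0`
this element is regular and does occur. -/
theorem sum_down_cutoff [Finite S] (hρ : IsIrreducible ρ) {e : S} (he : IsMinimalSupport ρ e)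
    (s : S) : ∑ u ∈ (Set.toFinite (down hS s)).toFinset, cutoff ρ e u = ρ (e * s) := by
  have huniq : ∀ u ∈ down hS s, (u : S) * inv u = e → (u : S) = e * s := by
    rintro u hu rfl
    exact hu.symm
  by_cases h0 : ρ (e * s) = 0
  · rw [h0]
    refine Finset.sum_eq_zero fun u hu => ?_
    unfold cutoff
    split_ifs with h
    · rw [huniq u ((Set.Finite.mem_toFinset _).1 hu) h, h0]
    · rfl
  · obtain ⟨c, hc, hce⟩ := he.exists_areInverse hρ h0
    let u : regularPart hS := ⟨e * s, c, hc⟩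
    have hcu : c = (inv u : S) := AreInverse.eq_inv (u := u) hc
    have hue : (u : S) * inv u = e := by rw [← hcu]; exact hce
    have hu : u ∈ down hS s := by
      change (u : S) * inv u * s = e * s
      rw [hue]
    rw [Finset.sum_eq_single u]
    · exact if_pos hue
    · intro t ht htu
      exact if_neg fun h => htu (Subtype.ext (huniq t ((Set.Finite.mem_toFinset _).1 ht) h))
    · exact fun h => absurd ((Set.Finite.mem_toFinset _).2 hu) h

theorem extend_restrict_floorElt [Finite S] (t : regularPart hS) :
    extend (restrict ρ (regularPart hS)) (floorElt K t) =
      ∑ x ∈ (Set.toFinite {x : regularPart hS | x ≤ t}).toFinset, moebius x t • ρ x := by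
  rw [floorElt, map_sum]
  refine Finset.sum_congr rfl fun x _ => ?_
  rw [extend_single, Int.cast_smul_eq_zsmul]
  rfl

/-- Möbius inversion of `sum_down_cutoff`, because `x↓` is the order ideal below `x` when `x` is
regular. -/
theorem map_mul_extend_floorElt [Finite S] (hρ : IsIrreducible ρ) {e : S}
    (he : IsMinimalSupport ρ e) (t : regularPart hS) :
    ρ e * extend (restrict ρ (regularPart hS)) (floorElt K t) = cutoff ρ e t := by
  rw [extend_restrict_floorElt, Finset.mul_sum, ← sum_moebius_smul_sum (cutoff ρ e) t]
  refine Finset.sum_congr rfl fun x _ => ?_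
  rw [mul_smul_comm, ← map_mul, ← sum_down_cutoff (hS := hS) hρ he]
  have : down hS (x : S) = {y | y ≤ x} := Set.ext fun y => mem_down_iff_le
  simp only [this]

/-- An irreducible representation of `S` is recovered from its restriction to `R(S)`. -/
theorem extend_restrict_nu [Finite S] (hρ : IsIrreducible ρ) (a : MonoidAlgebra K S) :
    extend (restrict ρ (regularPart hS)) (nu K hS a) = extend ρ a := by
  suffices h : extend (restrict ρ (regularPart hS)) ∘ₗ nu K hS = extend ρ from
    LinearMap.congr_fun h a
  refine (MonoidAlgebra.basis S K).ext fun s => ?_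
  rw [LinearMap.comp_apply, nu, extend, extend, Module.Basis.constr_basis,
    Module.Basis.constr_basis, ← extend, map_sum]
  -- The zero representation has no minimal idempotents to test on, so it is treated apart.
  by_cases hzero : ∀ x, ρ x = 0
  · rw [hzero]
    refine Finset.sum_eq_zero fun t _ => ?_
    rw [extend_restrict_floorElt]
    exact Finset.sum_eq_zero fun x _ => by rw [hzero, smul_zero]
  · push Not at hzero
    obtain ⟨x, hx⟩ := hzero
    refine ext_iff_vecMul.2 fun v => ?_
    have hv : v ∈ Submodule.span K {w : Fin n → K | ∃ e, IsMinimalSupport ρ e ∧ w ᵥ* ρ e = w} :=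
      span_fixed_eq_top hρ hx ▸ Submodule.mem_top
    refine LinearMap.eqOn_span (f := vecMulLinear _) (g := vecMulLinear _) ?_ hv
    rintro w ⟨e, he, hwe⟩
    rw [vecMulLinear_apply, vecMulLinear_apply, ← hwe, vecMul_vecMul, vecMul_vecMul,
      Finset.mul_sum, ← map_mul, ← sum_down_cutoff (hS := hS) hρ he]
    exact congrArg _ (Finset.sum_congr rfl fun t _ => map_mul_extend_floorElt hρ he t)

theorem extend_mem_span_range {T : Type*} [Semigroup T] (σ : T →ₙ* Matrix (Fin n) (Fin n) K)
    (a : MonoidAlgebra K T) : extend σ a ∈ Submodule.span K (Set.range σ) := by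
  rw [extend, ← Module.Basis.constr_range (S := K) (MonoidAlgebra.basis T K)]
  exact LinearMap.mem_range_self _ _

/-- The matrices of `S` are linear combinations of those of `R(S)`. -/
theorem map_mem_span_range_restrict [Finite S] (hρ : IsIrreducible ρ) (s : S) :
    ρ s ∈ Submodule.span K (Set.range (restrict ρ (regularPart hS))) := by
  have h : extend ρ (MonoidAlgebra.single s 1) = ρ s := by rw [extend_single, one_smul]
  rw [← h, ← extend_restrict_nu (hS := hS) hρ]
  exact extend_mem_span_range _ _

end Representations

end CommIdem

end

theorem theorem8p5 {S : Type*} [Semigroup S] [Finite S]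
    (hS : CommIdem.IdempotentsCommute S) {K : Type*} [Field K] {n : ℕ}
    (ρ : S →ₙ* Matrix (Fin n) (Fin n) K) (hρ : CommIdem.IsIrreducible ρ) :
    CommIdem.IsIrreducible (CommIdem.restrict ρ (CommIdem.regularPart hS)) ∧
    ((∃ s : S, ρ s ≠ 0) →
      ∃ u : CommIdem.regularPart hS, CommIdem.restrict ρ (CommIdem.regularPart hS) u ≠ 0) ∧
    LinearMap.ker (CommIdem.nu K hS) ≤ LinearMap.ker (CommIdem.extend ρ) := by
  refine ⟨⟨hρ.1, fun W hW => hρ.2 W fun t w hw => ?_⟩, ?_, fun a ha => ?_⟩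
  -- The matrices preserving `W` are closed under linear combinations.
  · have h := CommIdem.map_mem_span_range_restrict (hS := hS) hρ t
    generalize ρ t = M at h ⊢
    induction h using Submodule.span_induction with
    | mem M hM => obtain ⟨u, rfl⟩ := hM; exact hW u w hw
    | zero => rw [Matrix.vecMul_zero]; exact W.zero_mem
    | add M N _ _ hM hN => rw [Matrix.vecMul_add]; exact W.add_mem hM hN
    | smul c M _ hM => rw [Matrix.vecMul_smul]; exact W.smul_mem c hM
  · rintro ⟨s, hs⟩
    by_contra! h
    apply hs
    have hmem := CommIdem.map_mem_span_range_restrict (hS := hS) hρ s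
    have hle : Submodule.span K (Set.range (CommIdem.restrict ρ (CommIdem.regularPart hS))) ≤ ⊥ :=
      Submodule.span_le.2 (by rintro _ ⟨u, rfl⟩; exact h u)
    exact (Submodule.mem_bot K).1 (hle hmem)
  · rw [LinearMap.mem_ker] at ha ⊢
    rw [← CommIdem.extend_restrict_nu (hS := hS) hρ, ha, map_zero]
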